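/- For integers $n,k\ge 0$ and $t$, let $J_\pm(n,k,t)$ be the graph whose vertices are the vectors in $\{-1,0,1\}^n$ with exactly $k$ nonzero coordinates, two distinct vertices being adjacent if and only if their scalar product equals $t$. Let $\alpha(G)$ denote the independence number of a graph $G$, i.e. the maximum size of a set of pairwise non-adjacent vertices. For integers $0\le D<m$ put \[ S(m,D)=\begin{cases}\sum_{j=0}^{d}\binom{m}{j} & \text{if } D=2d,\\[2pt] \binom{m-1}{d}+\sum_{j=0}^{d}\binom{m}{j} & \text{if } D=2d+1.\end{cases} \] **Theorem.** For every $k$ there is a number $n_0(k)$, depending only on $k$, such that for every $n>n_0(k)$ and every negative odd integer $t$ with $|t|\le k$, \[ \alpha\bigl(J_\pm(n,k,t)\bigr)=S\bigl(k,|t|-1\bigr)\binom{n}{k}. \] -/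

import Mathlib

/-- The vectors of `{-1, 0, 1}^n` with exactly `k` nonzero coordinates. -/
abbrev SignedVec (n k : ℕ) : Type :=
  {v : Fin n → SignType // (Finset.univ.filter (fun i => v i ≠ 0)).card = k}

/-- The standard scalar product of two vectors of `{-1, 0, 1}^n`, as an integer. -/
def signDot {n : ℕ} (v w : Fin n → SignType) : ℤ :=
  ∑ i, (v i : ℤ) * (w i : ℤ)

theorem signDot_comm {n : ℕ} (v w : Fin n → SignType) : signDot v w = signDot w v :=
  Finset.sum_congr rfl fun _ _ => mul_comm _ _

/-- The graph `J_±(n, k, t)`: its vertices are the vectors of `{-1, 0, 1}^n` with exactly `k`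
nonzero coordinates, and two distinct vertices are adjacent if and only if their scalar product
is `t`. -/
def signedJohnson (n k : ℕ) (t : ℤ) : SimpleGraph (SignedVec n k) where
  Adj v w := v ≠ w ∧ signDot v.1 w.1 = t
  symm := ⟨fun v w h => ⟨h.1.symm, (signDot_comm w.1 v.1).trans h.2⟩⟩
  loopless := ⟨fun _ h => h.1 rfl⟩

/-- Kleitman's bound `S(m, D)`, for `D < m`, on the size of a family of subsets of an `m`-element
set with Hamming diameter at most `D`: with `d = ⌊D / 2⌋` it is `∑_{j ≤ d} C(m, j)` if `D` is
even, and `C(m - 1, d) + ∑_{j ≤ d} C(m, j)` if `D` is odd. -/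
def kleitmanBound (m D : ℕ) : ℕ :=
  if Even D then ∑ j ∈ Finset.range (D / 2 + 1), m.choose j
  else (m - 1).choose (D / 2) + ∑ j ∈ Finset.range (D / 2 + 1), m.choose j

/-!
Write `t = -(2 * d + 1)`, `q = 2 * d + 1` and `K = ∑ j ≤ d, C(k, j)`, the size of a Hamming ball of
radius `d` in the `k`-cube; `K` is the Kleitman bound in question, since `|t| - 1 = 2 * d` is even.

*Lower bound.* Two vectors with at most `d` negative coordinates each have scalar product at least
`-2 * d > t`, and there are `K * C(n, k)` such vectors (`card_filter_card_signNeg_le`).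

*Upper bound.* Let `F` be independent. Call a `q`-set `T` with a sign pattern on `T` a conflict if
both the pattern and its opposite are restrictions to `T` of vectors of `F`. The supports of two
vectors with opposite restrictions to `T` must meet outside `T`, as otherwise the scalar product is
`-q`. Hence all vectors with the given restriction have supports meeting a fixed set of `k - q`
points outside `T`, and there are only `O(n ^ (k - q - 1))` of them (`card_signLink_mul_le`). Remove
all vectors taking part in conflicts. The sign patterns left on a given support differ pairwise in
at most `2 * d` places, so Kleitman's diameter theorem leaves at most `K` of them. Moreover, a
support containing the ground set `T` of a conflict carries fewer than `K`: an extremal family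
meets every pair of opposite patterns on `T` (`card_lt_of_inter_ne`). A conflict thus makes about
`n ^ (k - q)` supports deficient at the price of `O(n ^ (k - q - 1))` removed vectors, and by double
counting the deficiency outweighs the removal for large `n` (`card_conflictVecs_le`).

*Kleitman's theorem with uniqueness.* On a ground set of size at least `2 * d + 2` the families of
diameter at most `2 * d` and size at least `K` are the balls of radius `d`
(`exists_eq_ball_of_card_symmDiff_le`). Down-compressions reduce this to families with pairwise
unions of size at most `2 * d`; a ball is recovered from its compression because Kneser graphs are
connected. Families with small unions are treated by shifting a fixed point `m` to the other points
and induction on the ground set (`eq_filter_card_le_of_card_union_le`). On a ground set of size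
`2 * d + 1` the bound is the trivial one for families without complementary pairs.
-/

open Finset
open scoped symmDiff FinsetFamily

/-! ### Families with small pairwise unions -/

/-- The number of subsets of size at most `d` of an `m`-element set, that is, the size of a Hamming
ball of radius `d` in the `m`-dimensional cube. -/
def hammingBallCard (m d : ℕ) : ℕ := ∑ j ∈ range (d + 1), m.choose j

theorem hammingBallCard_succ_succ (m d : ℕ) :
    hammingBallCard (m + 1) (d + 1) = hammingBallCard m (d + 1) + hammingBallCard m d := by
  unfold hammingBallCard
  rw [sum_range_succ' (fun j => (m + 1).choose j), sum_range_succ' (fun j => m.choose j) (d + 1)]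
  simp only [Nat.choose_succ_succ, sum_add_distrib, Nat.choose_zero_right]
  ring

section Families

variable {α : Type*} [DecidableEq α]

theorem card_filter_card_le (S : Finset α) (d : ℕ) :
    #{A ∈ S.powerset | #A ≤ d} = hammingBallCard #S d := by
  have h : {A ∈ S.powerset | #A ≤ d} = (range (d + 1)).biUnion fun j => S.powersetCard j := by
    ext A
    simp [mem_powersetCard, and_comm]
  rw [h, card_biUnion]
  · simp [hammingBallCard]
  · intro i _ j _ hij
    exact S.pairwise_disjoint_powersetCard hij

theorem compress_singleton (j m : α) (A : Finset α) :
    UV.compress {j} {m} A = if j ∉ A ∧ m ∈ A then (insert j A).erase m else A := by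
  unfold UV.compress
  simp only [disjoint_singleton_left, singleton_subset_iff]
  split_ifs
  · ext x; simp; tauto
  · rfl

theorem mem_compression_singleton_cases {j m : α} {G : Finset (Finset α)} {A : Finset α}
    (hA : A ∈ UV.compression {j} {m} G) :
    (A ∈ G ∧ (j ∉ A → m ∈ A → (insert j A).erase m ∈ G)) ∨
      ∃ B ∈ G, j ∉ B ∧ m ∈ B ∧ A = (insert j B).erase m := by
  rw [UV.mem_compression, compress_singleton] at hA
  rcases hA with ⟨h1, h2⟩ | ⟨h1, B, hB, h2⟩
  · refine Or.inl ⟨h1, fun hj hm => ?_⟩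
    simpa [hj, hm] using h2
  · rw [compress_singleton] at h2
    split_ifs at h2 with h
    · exact Or.inr ⟨B, hB, h.1, h.2, h2.symm⟩
    · exact absurd (h2 ▸ hB) h1

/-- Replacing `m` by `j` wherever possible preserves an upper bound on the sizes of pairwise
unions. -/
theorem card_union_le_of_mem_compression {j m : α} (hjm : j ≠ m) {G : Finset (Finset α)} {e : ℕ}
    (hG : ∀ A ∈ G, ∀ B ∈ G, #(A ∪ B) ≤ e) :
    ∀ A ∈ UV.compression {j} {m} G, ∀ B ∈ UV.compression {j} {m} G, #(A ∪ B) ≤ e := by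
  have key : ∀ A B C : Finset α, j ∉ A → m ∈ A → A ∈ G → C ∈ G →
      B = (insert j A).erase m → (j ∉ C → m ∈ C → (insert j C).erase m ∈ G) →
      #(B ∪ C) ≤ e := by
    rintro A B C hjA hmA hA hC rfl h
    by_cases hj : j ∈ C
    · refine (card_le_card ?_).trans (hG A hA C hC)
      intro x
      simp only [mem_union, mem_erase, mem_insert]
      rintro (⟨_, rfl | h⟩ | h) <;> tauto
    · by_cases hm : m ∈ C
      · refine (card_le_card ?_).trans (hG A hA _ (h hj hm))
        intro x
        simp only [mem_union, mem_erase, mem_insert]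
        by_cases hx : x = m
        · subst hx; tauto
        · tauto
      · have : (insert j A).erase m ∪ C ⊆ insert j ((A ∪ C).erase m) := by
          intro x
          simp only [mem_union, mem_erase, mem_insert]
          by_cases hx : x = m
          · subst hx; tauto
          · tauto
        refine (card_le_card this).trans ((card_insert_le _ _).trans ?_)
        have := card_erase_add_one (mem_union_left C hmA)
        exact this.trans_le (hG A hA C hC)
  intro A hA B hB
  rcases mem_compression_singleton_cases hA with ⟨hA, hA'⟩ | ⟨A', hA', h1, h2, h3⟩
  · rcases mem_compression_singleton_cases hB with ⟨hB, hB'⟩ | ⟨B', hB', g1, g2, g3⟩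
    · exact hG A hA B hB
    · rw [union_comm]
      exact key B' B A g1 g2 hB' hA g3 hA'
  · rcases mem_compression_singleton_cases hB with ⟨hB, hB'⟩ | ⟨B', hB', g1, g2, g3⟩
    · exact key A' A B h1 h2 hA' hB h3 hB'
    · subst h3 g3
      have : (insert j A').erase m ∪ (insert j B').erase m ⊆ insert j ((A' ∪ B').erase m) := by
        intro x
        simp only [mem_union, mem_erase, mem_insert]
        tauto
      refine (card_le_card this).trans ((card_insert_le _ _).trans ?_)
      have := card_erase_add_one (mem_union_left B' h2)
      exact this.trans_le (hG A' hA' B' hB')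

/-- A family without complementary pairs contains at most half of all subsets. -/
theorem two_mul_card_le_of_sdiff_notMem {S : Finset α} {G : Finset (Finset α)}
    (hS : ∀ A ∈ G, A ⊆ S) (hG : ∀ A ∈ G, S \ A ∉ G) : 2 * #G ≤ 2 ^ #S := by
  have hinj : Set.InjOn (fun A => S \ A) (G : Set (Finset α)) := by
    intro A hA B hB h
    have h' : S \ (S \ A) = S \ (S \ B) := congrArg (S \ ·) h
    rwa [Finset.sdiff_sdiff_eq_self (hS A hA), Finset.sdiff_sdiff_eq_self (hS B hB)] at h'
  have hdisj : Disjoint G (G.image fun A => S \ A) := by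
    rw [disjoint_left]
    intro A hA hA'
    obtain ⟨B, hB, rfl⟩ := mem_image.1 hA'
    exact hG B hB hA
  have hsub : G ∪ G.image (fun A => S \ A) ⊆ S.powerset := by
    intro A hA
    rcases mem_union.1 hA with hA | hA
    · exact mem_powerset.2 (hS A hA)
    · obtain ⟨B, -, rfl⟩ := mem_image.1 hA
      exact mem_powerset.2 sdiff_subset
  have := card_le_card hsub
  rw [card_union_of_disjoint hdisj, card_image_of_injOn hinj, card_powerset] at this
  omega

theorem hammingBallCard_halfway (d : ℕ) : 2 * hammingBallCard (2 * d + 1) d = 2 ^ (2 * d + 1) := by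
  rw [hammingBallCard, Nat.sum_range_choose_halfway, pow_succ, pow_mul]
  norm_num [mul_comm]

/-- Removing the common point `m` improves the bound on pairwise unions by two, not just by one: if
`A ∪ B` had `2 * d + 1` elements, then replacing `m` by a point outside `A ∪ B` in one of the two
sets would give a union of size `2 * d + 3`. -/
theorem card_union_le_of_memberSubfamily {S : Finset α} {m : α} {d : ℕ} {G : Finset (Finset α)}
    (hd : 2 * d + 3 ≤ #S) (hG : ∀ A ∈ G, ∀ B ∈ G, #(A ∪ B) ≤ 2 * (d + 1))
    (hshift : ∀ j ∈ S, j ≠ m → ∀ A ∈ G, m ∈ A → j ∉ A → (insert j A).erase m ∈ G) :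
    ∀ A ∈ G.memberSubfamily m, ∀ B ∈ G.memberSubfamily m, #(A ∪ B) ≤ 2 * d := by
  intro A hA B hB
  rw [mem_memberSubfamily] at hA hB
  have h1 := hG _ hA.1 _ hB.1
  have hm : m ∉ A ∪ B := by simp [hA.2, hB.2]
  have h2 : insert m A ∪ insert m B = insert m (A ∪ B) := by ext; simp
  rw [h2, card_insert_of_notMem hm] at h1
  by_contra hlt
  have hcard : #(insert m (A ∪ B)) < #S := by rw [card_insert_of_notMem hm]; omega
  obtain ⟨j, hjS, hj⟩ := exists_mem_notMem_of_card_lt_card hcard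
  simp only [mem_insert, mem_union, not_or] at hj
  have h3 := hshift j hjS hj.1 _ hA.1 (mem_insert_self _ _) (by simp [hj.1, hj.2.1])
  have h4 := hG _ h3 _ hB.1
  have h5 : (insert j (insert m A)).erase m ∪ insert m B = insert j (insert m (A ∪ B)) := by
    ext x
    simp only [mem_union, mem_erase, mem_insert]
    by_cases hx : x = m
    · simp [hx]
    · simp [hx, or_assoc]
  rw [h5, card_insert_of_notMem (by simp [hj]), card_insert_of_notMem hm] at h4
  omega

/-- Uniqueness in Katona's theorem on families with small pairwise unions. -/
theorem eq_filter_card_le_of_card_union_le (S : Finset α) (d : ℕ) (G : Finset (Finset α))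
    (hd : 2 * d + 2 ≤ #S) (hS : ∀ A ∈ G, A ⊆ S) (hG : ∀ A ∈ G, ∀ B ∈ G, #(A ∪ B) ≤ 2 * d)
    (hcard : hammingBallCard #S d ≤ #G) : G = {A ∈ S.powerset | #A ≤ d} := by
  induction S using Finset.induction_on generalizing d G with
  | empty => simp at hd
  | insert m S hm ih =>
    have hball := card_filter_card_le (insert m S) d
    rw [← hball] at hcard
    -- It is enough to bound the members of `G` in size.
    suffices hle : ∀ A ∈ G, #A ≤ d from
      eq_of_subset_of_card_le (fun A hA => by simp [hle A hA, hS A hA]) hcard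
    obtain _ | d := d
    · intro A hA
      simpa using hG A hA A hA
    induction hw : #{A ∈ G | m ∈ A} using Nat.strong_induction_on generalizing G with
    | _ w ihw =>
    subst hw
    -- Either moving `m` to any other point keeps sets in `G`, or some shift changes `G` and leaves
    -- fewer sets containing `m`.
    by_cases hshift : ∀ j ∈ S, ∀ A ∈ G, m ∈ A → j ∉ A → (insert j A).erase m ∈ G
    · rw [card_insert_of_notMem hm] at hd
      have hshift' : ∀ j ∈ insert m S, j ≠ m → ∀ A ∈ G, m ∈ A → j ∉ A →
          (insert j A).erase m ∈ G := fun j hj hjm => hshift j (mem_of_mem_insert_of_ne hj hjm)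
      have hU1 := card_union_le_of_memberSubfamily (d := d)
        (by rw [card_insert_of_notMem hm]; omega) hG hshift'
      have hS1 : ∀ A ∈ G.memberSubfamily m, A ⊆ S := by
        intro A hA
        rw [mem_memberSubfamily] at hA
        exact (insert_subset_insert_iff hA.2).1 (hS _ hA.1)
      have hS0 : ∀ A ∈ G.nonMemberSubfamily m, A ⊆ S := by
        intro A hA
        rw [mem_nonMemberSubfamily] at hA
        exact (subset_insert_iff_of_notMem hA.2).1 (hS _ hA.1)
      have hU0 : ∀ A ∈ G.nonMemberSubfamily m, ∀ B ∈ G.nonMemberSubfamily m,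
          #(A ∪ B) ≤ 2 * (d + 1) := by
        intro A hA B hB
        rw [mem_nonMemberSubfamily] at hA hB
        exact hG A hA.1 B hB.1
      have hle0 : #(G.nonMemberSubfamily m) ≤ hammingBallCard #S (d + 1) := by
        rcases (show 2 * (d + 1) + 1 ≤ #S by omega).eq_or_lt with h | h
        · have h1 := two_mul_card_le_of_sdiff_notMem hS0 (by
            intro A hA hA'
            have := hU0 A hA _ hA'
            rw [union_sdiff_of_subset (hS0 A hA)] at this
            omega)
          rw [← h] at h1 ⊢
          have := hammingBallCard_halfway (d + 1)
          omega
        · by_contra hcon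
          have h1 := ih (d + 1) _ (by omega) hS0 hU0 (by omega)
          rw [h1, card_filter_card_le] at hcon
          omega
      have hG1 := ih d _ (by omega) hS1 hU1 (by
        have h1 := card_memberSubfamily_add_card_nonMemberSubfamily m G
        rw [hball, card_insert_of_notMem hm, hammingBallCard_succ_succ] at hcard
        omega)
      -- All sets of size `d + 1` belong to `G`: this is known for those containing `m`, and the
      -- others arise by moving `m`.
      have hfull : ∀ B ⊆ insert m S, #B = d + 1 → B ∈ G := by
        have hmem : ∀ C ⊆ S, #C = d → insert m C ∈ G := by
          intro C hC hCd
          have : C ∈ G.memberSubfamily m := by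
            rw [hG1]; simp [hC, hCd]
          exact (mem_memberSubfamily.1 this).1
        intro B hB hBd
        by_cases hmB : m ∈ B
        · have := hmem (B.erase m) (by rw [← subset_insert_iff]; exact hB)
            (by rw [card_erase_of_mem hmB]; omega)
          rwa [insert_erase hmB] at this
        · obtain ⟨b, hb⟩ : B.Nonempty := card_pos.1 (by omega)
          have hBS : B ⊆ S := (subset_insert_iff_of_notMem hmB).1 hB
          have h1 := hmem (B.erase b) ((erase_subset _ _).trans hBS)
            (by rw [card_erase_of_mem hb]; omega)
          have hbm : b ≠ m := fun h => hmB (h ▸ hb)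
          have h2 := hshift b (hBS hb) _ h1 (mem_insert_self _ _) (by simp [hbm])
          convert h2 using 1
          ext x
          simp only [mem_erase, mem_insert]
          by_cases hx : x = b
          · subst hx; tauto
          · by_cases hxm : x = m
            · subst hxm; tauto
            · tauto
      -- A set of size `d + 2` or more has too large a union with a suitable set of size `d + 1`.
      intro A hA
      by_contra hlt
      obtain ⟨B, hB, hBd⟩ : ∃ B ⊆ insert m S, #B = d + 1 ∧ 2 * (d + 1) + 1 ≤ #(A ∪ B) := by
        obtain ⟨A', hA', hA'd⟩ := exists_subset_card_eq (show d + 2 ≤ #A by omega)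
        have hA'S := hA'.trans (hS A hA)
        have h1 := card_sdiff_add_card_eq_card hA'S
        rw [card_insert_of_notMem hm] at h1
        obtain ⟨B, hB, hBd⟩ := exists_subset_card_eq
          (show d + 1 ≤ #(insert m S \ A') by omega)
        refine ⟨B, hB.trans sdiff_subset, hBd, ?_⟩
        have hdisj : Disjoint A' B := disjoint_of_subset_right hB disjoint_sdiff
        have := card_le_card (union_subset_union_left hA' : A' ∪ B ⊆ A ∪ B)
        rw [card_union_of_disjoint hdisj] at this
        omega
      have := hG A hA B (hfull B hB hBd.1)
      omega
    · push Not at hshift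
      obtain ⟨j, hjS, A₀, hA₀, hmA₀, hjA₀, hnot⟩ := hshift
      have hjm : j ≠ m := fun h => hm (h ▸ hjS)
      have hlt : #{A ∈ UV.compression {j} {m} G | m ∈ A} < #{A ∈ G | m ∈ A} := by
        refine card_lt_card ((ssubset_iff_of_subset ?_).2 ⟨A₀, by simp [hA₀, hmA₀], ?_⟩)
        · intro A hA
          rw [mem_filter] at hA ⊢
          rcases mem_compression_singleton_cases hA.1 with h | ⟨B, -, -, -, rfl⟩
          · exact ⟨h.1, hA.2⟩
          · simp at hA
        · rw [mem_filter]
          rintro ⟨h, -⟩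
          rcases mem_compression_singleton_cases h with h | ⟨B, -, -, -, rfl⟩
          · exact hnot (h.2 hjA₀ hmA₀)
          · simp at hmA₀
      have hle := ihw _ hlt (UV.compression {j} {m} G) (by
          intro A hA
          rcases mem_compression_singleton_cases hA with h | ⟨B, hB, -, -, rfl⟩
          · exact hS A h.1
          · exact (erase_subset _ _).trans
              (insert_subset (mem_insert_of_mem hjS) (hS B hB)))
        (card_union_le_of_mem_compression hjm hG) (by rwa [UV.card_compression]) rfl
      intro A hA
      rw [← UV.card_compress (u := {j}) (v := {m}) (by simp) A]
      exact hle _ (UV.compress_mem_compression hA)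

/-! ### Kleitman's diameter theorem -/

theorem symmDiff_insert_of_notMem {i : α} {A c : Finset α} (hA : i ∉ A) (hc : i ∉ c) :
    insert i A ∆ c = insert i (A ∆ c) := by
  ext x
  simp only [mem_symmDiff, mem_insert]
  by_cases hx : x = i
  · subst hx; tauto
  · tauto

theorem card_symmDiff_insert_left {i : α} {A c : Finset α} (hA : i ∉ A) (hc : i ∉ c) :
    #(insert i A ∆ c) = #(A ∆ c) + 1 := by
  rw [symmDiff_insert_of_notMem hA hc, card_insert_of_notMem (by simp [mem_symmDiff, hA, hc])]

theorem insert_symmDiff_insert {i : α} {A c : Finset α} (hA : i ∉ A) (hc : i ∉ c) :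
    insert i A ∆ insert i c = A ∆ c := by
  ext x
  simp only [mem_symmDiff, mem_insert]
  by_cases hx : x = i
  · subst hx; tauto
  · tauto

theorem inter_eq_sdiff_inter_of_subset_symmDiff {A B T : Finset α} (hT : T ⊆ A ∆ B) :
    B ∩ T = T \ (A ∩ T) := by
  ext x
  have := @hT x
  simp only [mem_inter, mem_sdiff, mem_symmDiff] at this ⊢
  tauto

theorem card_filter_card_symmDiff_le {S c : Finset α} (hc : c ⊆ S) (d : ℕ) :
    #{A ∈ S.powerset | #(A ∆ c) ≤ d} = hammingBallCard #S d := by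
  rw [← card_filter_card_le]
  refine card_nbij' (· ∆ c) (· ∆ c) ?_ ?_ ?_ ?_
  · intro A hA
    simp only [coe_filter, mem_powerset, Set.mem_ofPred_eq] at hA ⊢
    exact ⟨symmDiff_le_sup.trans (union_subset hA.1 hc), hA.2⟩
  · intro A hA
    simp only [coe_filter, mem_powerset, Set.mem_ofPred_eq] at hA ⊢
    exact ⟨symmDiff_le_sup.trans (union_subset hA.1 hc), by simpa using hA.2⟩
  · intro A _; simp
  · intro A _; simp

/-- Down-compression preserves an upper bound on the diameter. -/
theorem card_symmDiff_le_of_mem_downCompression {i : α} {G : Finset (Finset α)} {e : ℕ}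
    (hG : ∀ A ∈ G, ∀ B ∈ G, #(A ∆ B) ≤ e) : ∀ A ∈ 𝓓 i G, ∀ B ∈ 𝓓 i G, #(A ∆ B) ≤ e := by
  have key : ∀ A B : Finset α, A ∉ G → insert i A ∈ G → B ∈ G → B.erase i ∈ G →
      #(A ∆ B) ≤ e := by
    intro A B hA hA' hB hB'
    have hiA : i ∉ A := fun h => hA (insert_eq_of_mem h ▸ hA')
    by_cases hi : i ∈ B
    · have h := hG _ hA' _ hB'
      have h1 : B = insert i (B.erase i) := (insert_erase hi).symm
      rw [card_symmDiff_insert_left hiA (notMem_erase _ _)] at h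
      rw [h1, symmDiff_comm, card_symmDiff_insert_left (notMem_erase _ _) hiA, symmDiff_comm]
      exact h
    · have h := hG _ hA' _ hB
      rw [card_symmDiff_insert_left hiA hi] at h
      omega
  intro A hA B hB
  rw [Down.mem_compression] at hA hB
  rcases hA with ⟨hA, hA'⟩ | ⟨hA, hA'⟩ <;> rcases hB with ⟨hB, hB'⟩ | ⟨hB, hB'⟩
  · exact hG A hA B hB
  · rw [symmDiff_comm]; exact key B A hB hB' hA hA'
  · exact key A B hA hA' hB hB'
  · have h := hG _ hA' _ hB'
    rwa [insert_symmDiff_insert (fun hi => hA (by rwa [insert_eq_of_mem hi] at hA'))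
      (fun hi => hB (by rwa [insert_eq_of_mem hi] at hB'))] at h

/-- The Kneser graph on the `d`-subsets of a set with more than `2 * d` elements is connected. -/
theorem kneser_induction {U : Finset α} {d : ℕ} (hU : 2 * d + 1 ≤ #U) {p : Finset α → Prop}
    (hp : ∀ D ⊆ U, ∀ E ⊆ U, #D = d → #E = d → Disjoint D E → p D → p E) :
    ∀ D ⊆ U, ∀ E ⊆ U, #D = d → #E = d → p D → p E := by
  intro D hD E hE hDd hEd hpD
  induction hw : #(D \ E) generalizing D with
  | zero =>
    have h1 : D ⊆ E := sdiff_eq_empty_iff_subset.1 (card_eq_zero.1 hw)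
    rwa [← eq_of_subset_of_card_le h1 (by omega)]
  | succ w ih =>
    obtain ⟨a, ha⟩ : (D \ E).Nonempty := card_pos.1 (by omega)
    obtain ⟨b, hb⟩ : (E \ D).Nonempty := by
      have h1 := card_sdiff_add_card_inter D E
      have h2 := card_sdiff_add_card_inter E D
      rw [inter_comm] at h2
      exact card_pos.1 (by omega)
    rw [mem_sdiff] at ha hb
    have hD₁ : insert b (D.erase a) ⊆ U :=
      insert_subset (hE hb.1) ((erase_subset _ _).trans hD)
    have hD₁d : #(insert b (D.erase a)) = d := by
      rw [card_insert_of_notMem (by simp [hb.2]), card_erase_of_mem ha.1]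
      have := card_pos.2 ⟨a, ha.1⟩
      omega
    -- A set disjoint from `D` and from the exchanged set links the two.
    have hins : insert b D ⊆ U := insert_subset (hE hb.1) hD
    have hc := card_sdiff_add_card_eq_card hins
    rw [card_insert_of_notMem hb.2] at hc
    obtain ⟨F, hF, hFd⟩ := exists_subset_card_eq (show d ≤ #(U \ insert b D) by omega)
    have hdisj : Disjoint (insert b D) F := disjoint_of_subset_right hF disjoint_sdiff
    have hFU : F ⊆ U := hF.trans sdiff_subset
    have hpF := hp D hD F hFU hDd hFd (disjoint_of_subset_left (subset_insert _ _) hdisj) hpD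
    have hpD₁ := hp F hFU _ hD₁ hFd hD₁d
      (disjoint_of_subset_left (insert_subset_insert _ (erase_subset _ _)) hdisj).symm hpF
    refine ih _ hD₁ hD₁d hpD₁ ?_
    have h1 : insert b (D.erase a) \ E = (D \ E).erase a := by
      ext x
      simp only [mem_sdiff, mem_insert, mem_erase]
      by_cases hx : x = b
      · subst hx; tauto
      · tauto
    rw [h1, card_erase_of_mem (by simp [ha]), hw]
    rfl

/-- If the down-compression of a family of diameter at most `2 * d` is a ball, so is the family:
on the sphere of radius `d` the choice between a set and the set with `i` inserted is constant
along edges of a Kneser graph, which is connected. -/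
theorem exists_ball_of_downCompression_eq_ball {S c : Finset α} {i : α} {d : ℕ}
    {G : Finset (Finset α)} (hd : 2 * d + 2 ≤ #S) (hi : i ∈ S) (hcS : c ⊆ S)
    (hG : ∀ A ∈ G, ∀ B ∈ G, #(A ∆ B) ≤ 2 * d)
    (hball : 𝓓 i G = {A ∈ S.powerset | #(A ∆ c) ≤ d}) :
    ∃ c' ⊆ S, G = {A ∈ S.powerset | #(A ∆ c') ≤ d} := by
  have hmem : ∀ A, (A ∈ G ∧ A.erase i ∈ G ∨ A ∉ G ∧ insert i A ∈ G) ↔ A ⊆ S ∧ #(A ∆ c) ≤ d := by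
    intro A
    rw [← Down.mem_compression, hball]
    simp
  have hU : #(S.erase i) + 1 = #S := card_erase_add_one hi
  -- It is enough to find a ball inside the family, since the sizes agree.
  suffices h : ∃ c' ⊆ S, ∀ A ⊆ S, #(A ∆ c') ≤ d → A ∈ G by
    obtain ⟨c', hc', h⟩ := h
    refine ⟨c', hc', (eq_of_subset_of_card_le (fun A hA => ?_) ?_).symm⟩
    · simp only [mem_filter, mem_powerset] at hA
      exact h A hA.1 hA.2
    · rw [card_filter_card_symmDiff_le hc', ← card_filter_card_symmDiff_le hcS, ← hball,
        Down.card_compression]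
  -- The compression is closed under erasing `i`, so the centre cannot contain `i`.
  have hic : i ∉ c := by
    intro hic
    obtain ⟨D, hD, hDd⟩ := exists_subset_card_eq (show d ≤ #(S.erase i) by omega)
    have hiD : i ∉ D := fun h => notMem_erase i S (hD h)
    have h1 : c ∆ D ∈ 𝓓 i G := by
      rw [hball]
      simp only [mem_filter, mem_powerset]
      refine ⟨symmDiff_le_sup.trans (union_subset hcS (hD.trans (erase_subset _ _))), ?_⟩
      rw [symmDiff_comm c D, symmDiff_symmDiff_cancel_right, hDd]
    have h2 := Down.erase_mem_compression_of_mem_compression h1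
    rw [hball] at h2
    simp only [mem_filter, mem_powerset] at h2
    have h3 : (c ∆ D).erase i ∆ c = insert i D := by
      ext x
      simp only [mem_symmDiff, mem_erase, mem_insert]
      by_cases hx : x = i
      · subst hx; tauto
      · tauto
    rw [h3, card_insert_of_notMem hiD] at h2
    omega
  -- Inside the ball both `B` and `insert i B` are in the family, on its boundary at least one is.
  have hinner : ∀ B ⊆ S, i ∉ B → #(B ∆ c) < d → B ∈ G ∧ insert i B ∈ G := by
    intro B hB hiB hlt
    have h1 := (hmem (insert i B)).2 ⟨insert_subset hi hB, by
      rw [card_symmDiff_insert_left hiB hic]; omega⟩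
    rw [erase_insert hiB, insert_idem] at h1
    tauto
  have houter : ∀ B ⊆ S, i ∉ B → #(B ∆ c) ≤ d → B ∈ G ∨ insert i B ∈ G := by
    intro B hB hiB hle
    have h1 := (hmem B).2 ⟨hB, hle⟩
    tauto
  have hsub : ∀ D ⊆ S.erase i, c ∆ D ⊆ S ∧ i ∉ c ∆ D ∧ (c ∆ D) ∆ c = D := by
    intro D hD
    refine ⟨symmDiff_le_sup.trans (union_subset hcS (hD.trans (erase_subset _ _))), ?_, ?_⟩
    · have : i ∉ D := fun h => notMem_erase i S (hD h)
      simp [mem_symmDiff, hic, this]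
    · rw [symmDiff_comm c D, symmDiff_symmDiff_cancel_right]
  have hconn := kneser_induction (U := S.erase i) (d := d) (by omega) (p := fun D => c ∆ D ∈ G) (by
    intro D hD E hE hDd hEd hdisj hpD
    obtain ⟨hE1, hE2, hE3⟩ := hsub E hE
    rcases houter _ hE1 hE2 (by rw [hE3, hEd]) with h | h
    · exact h
    · have h1 := hG _ h _ hpD
      rw [card_symmDiff_insert_left hE2 (hsub D hD).2.1] at h1
      have h2 : (c ∆ E) ∆ (c ∆ D) = E ∪ D := by
        rw [symmDiff_symmDiff_symmDiff_comm, symmDiff_self, bot_symmDiff]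
        exact hdisj.symm.symmDiff_eq_sup
      rw [h2, card_union_of_disjoint hdisj.symm] at h1
      omega)
  have hshape : ∀ A ⊆ S, i ∉ A → c ∆ (A ∆ c) = A ∧ A ∆ c ⊆ S.erase i := by
    intro A hA hiA
    refine ⟨by rw [symmDiff_comm A c, symmDiff_symmDiff_cancel_left], fun x hx => ?_⟩
    have h1 : x ∈ A ∪ c := symmDiff_le_sup (a := A) (b := c) hx
    refine mem_erase.2 ⟨?_, union_subset hA hcS h1⟩
    rintro rfl
    simp [hiA, hic] at h1
  by_cases hall : ∃ D ⊆ S.erase i, #D = d ∧ c ∆ D ∈ G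
  · obtain ⟨D, hD, hDd, hDG⟩ := hall
    refine ⟨c, hcS, fun A hA hle => ?_⟩
    by_cases hiA : i ∈ A
    · rw [← insert_erase hiA] at hle ⊢
      rw [card_symmDiff_insert_left (notMem_erase _ _) hic] at hle
      exact (hinner _ ((erase_subset _ _).trans hA) (notMem_erase _ _) (by omega)).2
    · rcases hle.lt_or_eq with h | h
      · exact (hinner A hA hiA h).1
      · have h1 := hshape A hA hiA
        have := hconn D hD _ h1.2 hDd h hDG
        rwa [h1.1] at this
  · refine ⟨insert i c, insert_subset hi hcS, fun A hA hle => ?_⟩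
    by_cases hiA : i ∈ A
    · have hA' := (erase_subset i A).trans hA
      have hn := notMem_erase i A
      rw [← insert_erase hiA] at hle ⊢
      rw [insert_symmDiff_insert hn hic] at hle
      rcases hle.lt_or_eq with h | h
      · exact (hinner _ hA' hn h).2
      · refine (houter _ hA' hn h.le).resolve_left fun hG' => hall ?_
        have h1 := hshape _ hA' hn
        exact ⟨_, h1.2, h, by rwa [h1.1]⟩
    · rw [symmDiff_comm, card_symmDiff_insert_left hic hiA, symmDiff_comm] at hle
      exact (hinner A hA hiA (by omega)).1

theorem sum_card_downCompression_lt {i : α} {G : Finset (Finset α)} {A₀ : Finset α}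
    (hA₀ : A₀ ∈ G) (hnot : A₀.erase i ∉ G) : ∑ A ∈ 𝓓 i G, #A < ∑ A ∈ G, #A := by
  have hmem : ∀ A ∈ G, A.erase i ∉ G → i ∈ A := by
    intro A hA h
    by_contra hi
    exact h (by rwa [erase_eq_of_notMem hi])
  have hinj : Set.InjOn (fun A : Finset α => A.erase i) ({A ∈ G | A.erase i ∉ G} : Finset _) := by
    intro A hA B hB h
    simp only [coe_filter, Set.mem_ofPred_eq] at hA hB
    exact (erase_injOn' i) (hmem A hA.1 hA.2) (hmem B hB.1 hB.2) h
  rw [Down.compression, sum_disjUnion, filter_image, sum_image hinj,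
    ← sum_filter_add_sum_filter_not G (fun A => A.erase i ∈ G)]
  refine Nat.add_lt_add_left (sum_lt_sum (fun A _ => card_le_card (erase_subset _ _)) ?_) _
  exact ⟨A₀, by simp [hA₀, hnot], card_erase_lt_of_mem (hmem A₀ hA₀ hnot)⟩

/-- Uniqueness in Kleitman's diameter theorem for even diameters: in dimension at least `2 * d + 2`
the extremal families are the balls of radius `d`. -/
theorem exists_eq_ball_of_card_symmDiff_le {S : Finset α} {d : ℕ} {G : Finset (Finset α)}
    (hd : 2 * d + 2 ≤ #S) (hS : ∀ A ∈ G, A ⊆ S) (hG : ∀ A ∈ G, ∀ B ∈ G, #(A ∆ B) ≤ 2 * d)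
    (hcard : hammingBallCard #S d ≤ #G) :
    ∃ c ⊆ S, G = {A ∈ S.powerset | #(A ∆ c) ≤ d} := by
  induction hw : ∑ A ∈ G, #A using Nat.strong_induction_on generalizing G with
  | _ w ih =>
  subst hw
  -- A family closed under erasing points has small unions, as `A ∪ B = (A \ B) ∆ B`; otherwise some
  -- down-compression decreases the total size.
  by_cases hlow : ∀ i, ∀ A ∈ G, A.erase i ∈ G
  · have hsdiff : ∀ (B A : Finset α), A ∈ G → A \ B ∈ G := by
      intro B
      induction B using Finset.induction_on with
      | empty => simp
      | insert i B _ ihB =>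
        intro A hA
        rw [sdiff_insert]
        exact hlow i _ (ihB A hA)
    refine ⟨∅, empty_subset _, ?_⟩
    have := eq_filter_card_le_of_card_union_le S d G hd hS (by
      intro A hA B hB
      have h1 := hG _ (hsdiff B A hA) _ hB
      rwa [(disjoint_sdiff_self_left : Disjoint (A \ B) B).symmDiff_eq_sup, sup_eq_union,
        sdiff_union_self_eq_union] at h1) hcard
    rw [this]
    ext A
    simp [← bot_eq_empty]
  · push Not at hlow
    obtain ⟨i, A₀, hA₀, hnot⟩ := hlow
    have hi : i ∈ S := by
      refine hS A₀ hA₀ ?_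
      by_contra h
      exact hnot (by rwa [erase_eq_of_notMem h])
    obtain ⟨c, hc, hball⟩ := ih _ (sum_card_downCompression_lt hA₀ hnot) (G := 𝓓 i G) (by
        intro A hA
        rw [Down.mem_compression] at hA
        rcases hA with h | h
        · exact hS A h.1
        · exact (subset_insert _ _).trans (hS _ h.2))
      (card_symmDiff_le_of_mem_downCompression hG) (by rwa [Down.card_compression]) rfl
    exact exists_ball_of_downCompression_eq_ball hd hi hc hG hball

theorem sdiff_notMem_of_card_symmDiff_le {S : Finset α} {d : ℕ} {G : Finset (Finset α)}
    (hd : #S = 2 * d + 1) (hS : ∀ A ∈ G, A ⊆ S)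
    (hG : ∀ A ∈ G, ∀ B ∈ G, #(A ∆ B) ≤ 2 * d) : ∀ A ∈ G, S \ A ∉ G := by
  intro A hA hA'
  have h1 := hG A hA _ hA'
  rw [(disjoint_sdiff : Disjoint A (S \ A)).symmDiff_eq_sup, sup_eq_union,
    union_sdiff_of_subset (hS A hA), hd] at h1
  omega

/-- Kleitman's diameter theorem for even diameters. -/
theorem card_le_of_card_symmDiff_le {S : Finset α} {d : ℕ} {G : Finset (Finset α)}
    (hd : 2 * d + 1 ≤ #S) (hS : ∀ A ∈ G, A ⊆ S) (hG : ∀ A ∈ G, ∀ B ∈ G, #(A ∆ B) ≤ 2 * d) :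
    #G ≤ hammingBallCard #S d := by
  rcases hd.eq_or_lt with h | h
  · have h1 := two_mul_card_le_of_sdiff_notMem hS (sdiff_notMem_of_card_symmDiff_le h.symm hS hG)
    have h2 := hammingBallCard_halfway d
    rw [← h] at h1 ⊢
    omega
  · by_contra hcon
    obtain ⟨c, hc, rfl⟩ := exists_eq_ball_of_card_symmDiff_le h hS hG (by omega)
    exact hcon (card_filter_card_symmDiff_le hc d).le

/-- A family attaining Kleitman's bound meets, on every set `T` of size `2 * d + 1`, every
complementary pair of traces. -/
theorem card_lt_of_inter_ne {S T X : Finset α} {d : ℕ} {G : Finset (Finset α)}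
    (hS : ∀ A ∈ G, A ⊆ S) (hG : ∀ A ∈ G, ∀ B ∈ G, #(A ∆ B) ≤ 2 * d)
    (hTS : T ⊆ S) (hT : #T = 2 * d + 1) (hX : X ⊆ T)
    (hGX : ∀ A ∈ G, A ∩ T ≠ X) (hGX' : ∀ A ∈ G, A ∩ T ≠ T \ X) :
    #G < hammingBallCard #S d := by
  rcases (hT ▸ card_le_card hTS : 2 * d + 1 ≤ #S).eq_or_lt with h | h
  · obtain rfl : T = S := eq_of_subset_of_card_le hTS (by omega)
    -- Here `G` has no complementary pair, and adding `X` creates none.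
    have hXG : X ∉ G := fun hm => hGX X hm (inter_eq_left.2 hX)
    have hXG' : T \ X ∉ G := fun hm => hGX' _ hm (inter_eq_left.2 sdiff_subset)
    have hne : T \ X ≠ X := by
      intro he
      have h1 : Disjoint X (T \ X) := disjoint_sdiff
      rw [he, disjoint_self_iff_empty] at h1
      subst h1
      rw [sdiff_empty] at he
      simp [he] at hT
    have h1 := two_mul_card_le_of_sdiff_notMem (S := T) (G := insert X G) (by
        intro A hA
        rcases mem_insert.1 hA with rfl | hA
        · exact hX
        · exact hS A hA) (by
        intro A hA
        rw [mem_insert, not_or]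
        rcases mem_insert.1 hA with rfl | hAG
        · exact ⟨hne, hXG'⟩
        · refine ⟨fun he => ?_, sdiff_notMem_of_card_symmDiff_le hT hS hG A hAG⟩
          rw [← he, Finset.sdiff_sdiff_eq_self (hS A hAG)] at hXG'
          exact hXG' hAG)
    rw [card_insert_of_notMem hXG] at h1
    have h2 := hammingBallCard_halfway d
    rw [← h] at h1 ⊢
    omega
  · by_contra hcon
    obtain ⟨c, hc, rfl⟩ := exists_eq_ball_of_card_symmDiff_le h hS hG (by omega)
    have key : ∀ Y ⊆ T, #(Y ∆ (c ∩ T)) ≤ d →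
        ∃ A ∈ {A ∈ S.powerset | #(A ∆ c) ≤ d}, A ∩ T = Y := by
      intro Y hY hYd
      refine ⟨Y ∪ c \ T, ?_, ?_⟩
      · simp only [mem_filter, mem_powerset]
        refine ⟨union_subset (hY.trans hTS) (sdiff_subset.trans hc), ?_⟩
        convert hYd using 2
        ext x
        have := @hY x
        simp only [mem_symmDiff, mem_union, mem_sdiff, mem_inter]
        tauto
      · ext x
        have := @hY x
        simp only [mem_union, mem_sdiff, mem_inter]
        tauto
    -- One of the two traces is within distance `d` of the trace of the centre.
    have hsum : #(X ∆ (c ∩ T)) + #((T \ X) ∆ (c ∩ T)) = 2 * d + 1 := by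
      rw [← hT, ← card_union_of_disjoint]
      · congr 1
        ext x
        have := @hX x
        simp only [mem_symmDiff, mem_union, mem_sdiff, mem_inter]
        tauto
      · rw [disjoint_left]
        intro x
        have := @hX x
        simp only [mem_symmDiff, mem_sdiff, mem_inter]
        tauto
    rcases le_or_gt #(X ∆ (c ∩ T)) d with h1 | h1
    · obtain ⟨A, hA, hAX⟩ := key X hX h1
      exact hGX A hA hAX
    · obtain ⟨A, hA, hAX⟩ := key (T \ X) sdiff_subset (by omega)
      exact hGX' A hA hAX

end Families

/-! ### Sign vectors and their supports -/

section SignVectors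

variable {n k : ℕ}

/-- The support of a sign vector. -/
def signSupp (v : Fin n → SignType) : Finset (Fin n) := {i | v i ≠ 0}

/-- The set of negative coordinates of a sign vector. -/
def signNeg (v : Fin n → SignType) : Finset (Fin n) := {i | v i = -1}

@[simp]
theorem mem_signSupp {v : Fin n → SignType} {i : Fin n} : i ∈ signSupp v ↔ v i ≠ 0 := by
  simp [signSupp]

@[simp]
theorem mem_signNeg {v : Fin n → SignType} {i : Fin n} : i ∈ signNeg v ↔ v i = -1 := by
  simp [signNeg]

theorem card_signSupp (v : SignedVec n k) : #(signSupp v.1) = k := v.2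

theorem signNeg_subset_signSupp (v : Fin n → SignType) : signNeg v ⊆ signSupp v := by
  intro i hi
  rw [mem_signNeg] at hi
  simp [hi]

theorem eq_of_signSupp_eq_of_signNeg_eq {v w : Fin n → SignType} (h : signSupp v = signSupp w)
    (h' : signNeg v = signNeg w) : v = w := by
  funext i
  have h1 := Finset.ext_iff.1 h i
  have h2 := Finset.ext_iff.1 h' i
  rw [mem_signSupp, mem_signSupp] at h1
  rw [mem_signNeg, mem_signNeg] at h2
  revert h1 h2
  generalize v i = a
  generalize w i = b
  revert a b
  decide

theorem exists_signVec {S A : Finset (Fin n)} (hA : A ⊆ S) :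
    ∃ v : Fin n → SignType, signSupp v = S ∧ signNeg v = A := by
  refine ⟨fun i => if i ∈ A then -1 else if i ∈ S then 1 else 0, ?_, ?_⟩
  · ext i
    have := @hA i
    rw [mem_signSupp]
    split_ifs with h1 h2 <;> simp_all
  · ext i
    rw [mem_signNeg]
    split_ifs with h1 h2 <;> simp_all

theorem signDot_eq (v w : Fin n → SignType) :
    signDot v w = #(signSupp v ∩ signSupp w) -
      2 * #((signNeg v ∆ signNeg w) ∩ (signSupp v ∩ signSupp w)) := by
  have h1 : ∀ A : Finset (Fin n), (#A : ℤ) = ∑ i, if i ∈ A then 1 else 0 := by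
    intro A; simp
  rw [h1, h1, mul_sum, ← sum_sub_distrib]
  refine sum_congr rfl fun i _ => ?_
  simp only [mem_inter, mem_symmDiff, mem_signSupp, mem_signNeg]
  generalize v i = a
  generalize w i = b
  revert a b
  decide

theorem neg_le_signDot {v w : Fin n → SignType} {d : ℕ} (hv : #(signNeg v) ≤ d)
    (hw : #(signNeg w) ≤ d) : -(2 * d : ℤ) ≤ signDot v w := by
  rw [signDot_eq]
  have h1 : #((signNeg v ∆ signNeg w) ∩ (signSupp v ∩ signSupp w)) ≤
      #(signSupp v ∩ signSupp w) := card_le_card inter_subset_right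
  have h2 : #((signNeg v ∆ signNeg w) ∩ (signSupp v ∩ signSupp w)) ≤
      #(signNeg v ∪ signNeg w) := card_le_card (inter_subset_left.trans symmDiff_le_sup)
  have h3 := card_union_le (signNeg v) (signNeg w)
  omega

theorem card_filter_signSupp_eq (S : Finset (Fin n)) (F : Finset (SignedVec n k)) :
    #(({v ∈ F | signSupp v.1 = S}).image fun v => signNeg v.1) = #{v ∈ F | signSupp v.1 = S} := by
  refine card_image_of_injOn fun v hv w hw h => ?_
  simp only [coe_filter, Set.mem_ofPred_eq] at hv hw
  exact Subtype.ext (eq_of_signSupp_eq_of_signNeg_eq (hv.2.trans hw.2.symm) h)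

theorem card_filter_card_signNeg_le (n k d : ℕ) :
    #{v : SignedVec n k | #(signNeg v.1) ≤ d} = hammingBallCard k d * n.choose k := by
  have hmaps : ∀ v ∈ ({v | #(signNeg v.1) ≤ d} : Finset (SignedVec n k)),
      signSupp v.1 ∈ (univ : Finset (Fin n)).powersetCard k :=
    fun v _ => mem_powersetCard.2 ⟨subset_univ _, card_signSupp v⟩
  have hfib : ∀ S ∈ (univ : Finset (Fin n)).powersetCard k,
      #{v ∈ ({v | #(signNeg v.1) ≤ d} : Finset (SignedVec n k)) | signSupp v.1 = S} =
        hammingBallCard k d := by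
    intro S hS
    rw [mem_powersetCard] at hS
    have hk : hammingBallCard k d = #{A ∈ S.powerset | #A ≤ d} := by
      rw [card_filter_card_le, hS.2]
    rw [← card_filter_signSupp_eq, hk]
    congr 1
    ext A
    simp only [mem_image, mem_filter, mem_univ, true_and, mem_powerset]
    constructor
    · rintro ⟨v, ⟨hv, rfl⟩, rfl⟩
      exact ⟨signNeg_subset_signSupp _, hv⟩
    · rintro ⟨hA, hAd⟩
      obtain ⟨v, hv, rfl⟩ := exists_signVec hA
      exact ⟨⟨v, (congrArg card hv).trans hS.2⟩, ⟨hAd, hv⟩, rfl⟩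
  rw [card_eq_sum_card_fiberwise hmaps, sum_congr rfl hfib]
  simp [mul_comm]

theorem card_filter_superset {U : Finset (Fin n)} (hU : #U ≤ k) :
    #{S ∈ (univ : Finset (Fin n)).powersetCard k | U ⊆ S} = (n - #U).choose (k - #U) := by
  have h1 : (n - #U).choose (k - #U) = #((univ \ U).powersetCard (k - #U)) := by
    rw [card_powersetCard, card_sdiff_of_subset (subset_univ _), card_univ, Fintype.card_fin]
  rw [h1]
  refine card_nbij' (· \ U) (· ∪ U) ?_ ?_ ?_ ?_
  · intro S hS
    simp only [coe_filter, mem_powersetCard, Set.mem_ofPred_eq, mem_coe] at hS ⊢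
    refine ⟨sdiff_subset_sdiff hS.1.1 subset_rfl, ?_⟩
    rw [card_sdiff_of_subset hS.2, hS.1.2]
  · intro S hS
    simp only [coe_filter, mem_powersetCard, Set.mem_ofPred_eq, mem_coe] at hS ⊢
    refine ⟨⟨subset_univ _, ?_⟩, subset_union_right⟩
    rw [card_union_of_disjoint (disjoint_of_subset_left hS.1 sdiff_disjoint)]
    omega
  · intro S hS
    simp only [coe_filter, mem_powersetCard, Set.mem_ofPred_eq] at hS
    exact sdiff_union_of_subset hS.2
  · intro S hS
    simp only [mem_powersetCard, mem_coe] at hS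
    exact union_sdiff_cancel_right (disjoint_of_subset_left hS.1 sdiff_disjoint)

theorem card_filter_subset_signSupp_le {U : Finset (Fin n)} (hU : #U ≤ k) :
    #{v : SignedVec n k | U ⊆ signSupp v.1} ≤ 2 ^ k * (n - #U).choose (k - #U) := by
  rw [← card_filter_superset hU]
  refine (card_le_mul_card_image (f := fun v => signSupp v.1) _ (2 ^ k) ?_).trans
    (Nat.mul_le_mul_left _ (card_le_card ?_))
  · intro S hS
    obtain ⟨v, -, rfl⟩ := mem_image.1 hS
    have hk : 2 ^ k = #(signSupp v.1).powerset := by rw [card_powerset, card_signSupp]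
    rw [← card_filter_signSupp_eq, hk]
    refine card_le_card fun A hA => ?_
    obtain ⟨w, hw, rfl⟩ := mem_image.1 hA
    rw [mem_filter] at hw
    rw [mem_powerset, ← hw.2]
    exact signNeg_subset_signSupp _
  · intro S hS
    obtain ⟨v, hv, rfl⟩ := mem_image.1 hS
    rw [mem_filter] at hv
    exact mem_filter.2 ⟨mem_powersetCard.2 ⟨subset_univ _, card_signSupp v⟩, hv.2⟩

/-! ### Conflicts in an independent set -/

/-- The vectors of `F` whose restriction to `T` has full support and negative set `X`. -/
def signLink (F : Finset (SignedVec n k)) (T X : Finset (Fin n)) : Finset (SignedVec n k) :=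
  {v ∈ F | T ⊆ signSupp v.1 ∧ signNeg v.1 ∩ T = X}

theorem mem_signLink {F : Finset (SignedVec n k)} {T X : Finset (Fin n)} {v : SignedVec n k} :
    v ∈ signLink F T X ↔ v ∈ F ∧ T ⊆ signSupp v.1 ∧ signNeg v.1 ∩ T = X := mem_filter

/-- Vectors with opposite restrictions to `T` have scalar product `-#T` if their supports meet
only in `T`. -/
theorem exists_mem_inter_of_mem_signLink {F : Finset (SignedVec n k)} {T X : Finset (Fin n)}
    (hF : ∀ v ∈ F, ∀ w ∈ F, signDot v.1 w.1 ≠ -(#T : ℤ)) (hX : X ⊆ T) {v w : SignedVec n k}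
    (hv : v ∈ signLink F T X) (hw : w ∈ signLink F T (T \ X)) :
    ∃ a ∈ signSupp w.1 \ T, a ∈ signSupp v.1 := by
  rw [mem_signLink] at hv hw
  by_contra! hcon
  refine hF v hv.1 w hw.1 ?_
  have h1 : signSupp v.1 ∩ signSupp w.1 = T := by
    refine Subset.antisymm (fun a ha => ?_) (subset_inter hv.2.1 hw.2.1)
    rw [mem_inter] at ha
    by_contra haT
    exact hcon a (mem_sdiff.2 ⟨ha.2, haT⟩) ha.1
  have h2 : (signNeg v.1 ∆ signNeg w.1) ∩ T = T := by
    have h3 := Finset.ext_iff.1 hv.2.2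
    have h4 := Finset.ext_iff.1 hw.2.2
    ext a
    have h5 := h3 a
    have h6 := h4 a
    have h7 := @hX a
    simp only [mem_inter, mem_symmDiff, mem_sdiff] at h5 h6 ⊢
    tauto
  rw [signDot_eq, h1, h2]
  ring

/-- If two opposite links on `T` are both nonempty, they are small: all their supports meet a
fixed set of size `k - #T` outside `T`. -/
theorem card_signLink_mul_le {F : Finset (SignedVec n k)} {T X : Finset (Fin n)}
    (hF : ∀ v ∈ F, ∀ w ∈ F, signDot v.1 w.1 ≠ -(#T : ℤ)) (hX : X ⊆ T)
    (hne : (signLink F T (T \ X)).Nonempty) (hkn : k ≤ n) :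
    #(signLink F T X) * (n - #T) ≤ 2 ^ k * k ^ 2 * (n - #T).choose (k - #T) := by
  obtain ⟨w, hw⟩ := hne
  have hTw : T ⊆ signSupp w.1 := (mem_signLink.1 hw).2.1
  have hTk : #T ≤ k := (card_le_card hTw).trans_eq (card_signSupp w)
  have hcardw : #(signSupp w.1 \ T) = k - #T := by
    rw [card_sdiff_of_subset hTw, card_signSupp]
  have hsub : signLink F T X ⊆ (signSupp w.1 \ T).biUnion fun a =>
      {v : SignedVec n k | insert a T ⊆ signSupp v.1} := by
    intro v hv
    obtain ⟨a, ha, hav⟩ := exists_mem_inter_of_mem_signLink hF hX hv hw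
    exact mem_biUnion.2 ⟨a, ha, mem_filter.2 ⟨mem_univ _,
      insert_subset hav (mem_signLink.1 hv).2.1⟩⟩
  have h1 : #(signLink F T X) ≤
      (k - #T) * (2 ^ k * (n - (#T + 1)).choose (k - (#T + 1))) := by
    refine (card_le_card hsub).trans ?_
    rw [← hcardw]
    refine card_biUnion_le_card_mul _ _ _ fun a ha => ?_
    have haT : a ∉ T := (mem_sdiff.1 ha).2
    have hpos := card_pos.2 ⟨a, ha⟩
    rw [← card_insert_of_notMem haT]
    exact card_filter_subset_signSupp_le (by rw [card_insert_of_notMem haT]; omega)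
  rcases hTk.eq_or_lt with h | h
  -- If `#T = k`, no point outside `T` is available and the link is empty.
  · have : #(signLink F T X) = 0 := by simpa [h] using h1
    simp [this]
  · obtain ⟨b, hb⟩ : ∃ b, n - #T = b + 1 := ⟨n - #T - 1, by omega⟩
    obtain ⟨c, hc⟩ : ∃ c, k - #T = c + 1 := ⟨k - #T - 1, by omega⟩
    have hb' : n - (#T + 1) = b := by omega
    have hc' : k - (#T + 1) = c := by omega
    rw [hb', hc', hc] at h1
    rw [hb, hc]
    have h2 := Nat.add_one_mul_choose_eq b c
    have h3 : (c + 1) ^ 2 ≤ k ^ 2 := Nat.pow_le_pow_left (by omega) 2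
    calc #(signLink F T X) * (b + 1) ≤ (c + 1) * (2 ^ k * b.choose c) * (b + 1) :=
          Nat.mul_le_mul_right _ h1
      _ = 2 ^ k * (c + 1) * ((b + 1) * b.choose c) := by ring
      _ = 2 ^ k * (c + 1) ^ 2 * (b + 1).choose (c + 1) := by rw [h2]; ring
      _ ≤ 2 ^ k * k ^ 2 * (b + 1).choose (c + 1) :=
          Nat.mul_le_mul_right _ (Nat.mul_le_mul_left _ h3)

/-- The pairs `(T, X)` with `#T = q` and `X ⊆ T` such that both `X` and its complement in `T` occur
as the negative set on `T` of a vector of `F`. -/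
def conflictPairs (F : Finset (SignedVec n k)) (q : ℕ) : Finset (Finset (Fin n) × Finset (Fin n)) :=
  {p | #p.1 = q ∧ p.2 ⊆ p.1 ∧ (signLink F p.1 p.2).Nonempty ∧
    (signLink F p.1 (p.1 \ p.2)).Nonempty}

theorem mem_conflictPairs {F : Finset (SignedVec n k)} {q : ℕ} {T X : Finset (Fin n)} :
    (T, X) ∈ conflictPairs F q ↔ #T = q ∧ X ⊆ T ∧ (signLink F T X).Nonempty ∧
      (signLink F T (T \ X)).Nonempty := by
  simp [conflictPairs]

theorem sdiff_mem_conflictPairs {F : Finset (SignedVec n k)} {q : ℕ} {T X : Finset (Fin n)}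
    (h : (T, X) ∈ conflictPairs F q) : (T, T \ X) ∈ conflictPairs F q := by
  rw [mem_conflictPairs] at h ⊢
  rw [Finset.sdiff_sdiff_eq_self h.2.1]
  exact ⟨h.1, sdiff_subset, h.2.2.2, h.2.2.1⟩

/-- The vectors of `F` taking part in a conflict. -/
def conflictVecs (F : Finset (SignedVec n k)) (q : ℕ) : Finset (SignedVec n k) :=
  (conflictPairs F q).biUnion fun p => signLink F p.1 p.2

/-- The `k`-sets containing the ground set of a conflict. -/
def conflictSupps (F : Finset (SignedVec n k)) (q : ℕ) : Finset (Finset (Fin n)) :=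
  {S ∈ (univ : Finset (Fin n)).powersetCard k | ∃ p ∈ conflictPairs F q, p.1 ⊆ S}

/-- Double counting of the conflicts and the supports containing their ground sets. -/
theorem card_conflictPairs_mul_le (F : Finset (SignedVec n k)) {q : ℕ} (hq : q ≤ k) :
    #(conflictPairs F q) * (n - q).choose (k - q) ≤ #(conflictSupps F q) * 4 ^ k := by
  refine card_mul_le_card_mul (fun p S => p.1 ⊆ S) ?_ ?_
  · rintro ⟨T, X⟩ hp
    obtain rfl := (mem_conflictPairs.1 hp).1
    rw [← card_filter_superset hq]
    refine card_le_card fun S hS => ?_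
    rw [mem_filter] at hS
    exact mem_filter.2 ⟨mem_filter.2 ⟨hS.1, (T, X), hp, hS.2⟩, hS.2⟩
  · intro S hS
    have hSk := (mem_powersetCard.1 (mem_filter.1 hS).1).2
    have h4 : 4 ^ k = #(S.powerset ×ˢ S.powerset) := by
      rw [card_product, card_powerset, hSk, ← mul_pow]; rfl
    rw [h4]
    refine card_le_card ?_
    rintro ⟨T, X⟩ hp
    rw [mem_bipartiteBelow] at hp
    exact mem_product.2 ⟨mem_powerset.2 hp.2,
      mem_powerset.2 ((mem_conflictPairs.1 hp.1).2.1.trans hp.2)⟩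

/-- Every conflict costs `O(n ^ (k - q - 1))` vectors but affects about `n ^ (k - q)` supports, so
for large `n` there are at least as many affected supports as vectors taking part in conflicts. -/
theorem card_conflictVecs_le {F : Finset (SignedVec n k)} {q : ℕ} (hq : q ≤ k)
    (hF : ∀ v ∈ F, ∀ w ∈ F, signDot v.1 w.1 ≠ -(q : ℤ)) (hn : 8 ^ k * k ^ 2 + k < n) :
    #(conflictVecs F q) ≤ #(conflictSupps F q) := by
  have h1 : #(conflictVecs F q) * (n - q) ≤
      #(conflictPairs F q) * (2 ^ k * k ^ 2 * (n - q).choose (k - q)) := by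
    refine (Nat.mul_le_mul_right _ card_biUnion_le).trans ?_
    rw [sum_mul, ← smul_eq_mul (#(conflictPairs F q))]
    refine sum_le_card_nsmul _ _ _ ?_
    rintro ⟨T, X⟩ hp
    obtain ⟨rfl, hX, -, hne⟩ := mem_conflictPairs.1 hp
    exact card_signLink_mul_le hF hX hne (by omega)
  have h2 := card_conflictPairs_mul_le F hq
  have h3 : #(conflictVecs F q) * (n - q) ≤ #(conflictSupps F q) * (n - q) := by
    calc #(conflictVecs F q) * (n - q)
        ≤ 2 ^ k * k ^ 2 * (#(conflictPairs F q) * (n - q).choose (k - q)) := by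
          refine h1.trans_eq ?_
          ring
      _ ≤ 2 ^ k * k ^ 2 * (#(conflictSupps F q) * 4 ^ k) := Nat.mul_le_mul_left _ h2
      _ = #(conflictSupps F q) * (8 ^ k * k ^ 2) := by
          rw [show (8 : ℕ) = 2 * 4 from rfl, mul_pow]
          ring
      _ ≤ #(conflictSupps F q) * (n - q) := Nat.mul_le_mul_left _ (by omega)
  exact Nat.le_of_mul_le_mul_right h3 (by omega)

/-- Without the vectors in conflicts, the vectors on each support form a family of diameter at
most `2 * d`, which is not extremal if the support contains the ground set of a conflict. -/
theorem card_filter_signSupp_sdiff_conflictVecs_le (F : Finset (SignedVec n k)) {d : ℕ}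
    (hd : 2 * d + 1 ≤ k) {S : Finset (Fin n)} (hS : #S = k) :
    #{v ∈ F \ conflictVecs F (2 * d + 1) | signSupp v.1 = S} ≤ hammingBallCard k d ∧
      (S ∈ conflictSupps F (2 * d + 1) →
        #{v ∈ F \ conflictVecs F (2 * d + 1) | signSupp v.1 = S} < hammingBallCard k d) := by
  rw [← card_filter_signSupp_eq]
  set G := ({v ∈ F \ conflictVecs F (2 * d + 1) | signSupp v.1 = S}).image
    fun v => signNeg v.1 with hG
  have hmem : ∀ A ∈ G, ∃ v ∈ F, v ∉ conflictVecs F (2 * d + 1) ∧ signSupp v.1 = S ∧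
      signNeg v.1 = A := by
    intro A hA
    obtain ⟨v, hv, rfl⟩ := mem_image.1 hA
    rw [mem_filter, mem_sdiff] at hv
    exact ⟨v, hv.1.1, hv.1.2, hv.2, rfl⟩
  have hGS : ∀ A ∈ G, A ⊆ S := by
    intro A hA
    obtain ⟨v, -, -, rfl, rfl⟩ := hmem A hA
    exact signNeg_subset_signSupp _
  have hdiam : ∀ A ∈ G, ∀ B ∈ G, #(A ∆ B) ≤ 2 * d := by
    intro A hA B hB
    by_contra hlt
    obtain ⟨T, hT, hTd⟩ := exists_subset_card_eq (show 2 * d + 1 ≤ #(A ∆ B) by omega)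
    have hTS : T ⊆ S := hT.trans (symmDiff_le_sup.trans (union_subset (hGS A hA) (hGS B hB)))
    obtain ⟨v, hvF, hv, hvS, rfl⟩ := hmem A hA
    obtain ⟨w, hwF, hw, hwS, rfl⟩ := hmem B hB
    have hvl : v ∈ signLink F T (signNeg v.1 ∩ T) := mem_signLink.2 ⟨hvF, hvS ▸ hTS, rfl⟩
    have hwl : w ∈ signLink F T (T \ (signNeg v.1 ∩ T)) :=
      mem_signLink.2 ⟨hwF, hwS ▸ hTS, inter_eq_sdiff_inter_of_subset_symmDiff hT⟩
    exact hv (mem_biUnion.2 ⟨(T, signNeg v.1 ∩ T),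
      mem_conflictPairs.2 ⟨hTd, inter_subset_right, ⟨v, hvl⟩, ⟨w, hwl⟩⟩, hvl⟩)
  rw [← hS] at hd
  rw [show hammingBallCard k d = hammingBallCard #S d by rw [hS]]
  refine ⟨card_le_of_card_symmDiff_le hd hGS hdiam, fun hSc => ?_⟩
  obtain ⟨⟨T, X⟩, hp, hTS⟩ := (mem_filter.1 hSc).2
  have hp' := mem_conflictPairs.1 hp
  have hnot : ∀ Y, (T, Y) ∈ conflictPairs F (2 * d + 1) → ∀ A ∈ G, A ∩ T ≠ Y := by
    rintro _ hY A hA rfl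
    obtain ⟨v, hvF, hv, hvS, rfl⟩ := hmem A hA
    exact hv (mem_biUnion.2 ⟨_, hY, mem_signLink.2 ⟨hvF, hvS ▸ hTS, rfl⟩⟩)
  exact card_lt_of_inter_ne hGS hdiam hTS hp'.1 hp'.2.1 (hnot X hp)
    (hnot _ (sdiff_mem_conflictPairs hp))

/-- The upper bound on the size of an independent set. -/
theorem card_le_of_signDot_ne {F : Finset (SignedVec n k)} {d : ℕ} (hd : 2 * d + 1 ≤ k)
    (hF : ∀ v ∈ F, ∀ w ∈ F, signDot v.1 w.1 ≠ -((2 * d + 1 : ℕ) : ℤ))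
    (hn : 8 ^ k * k ^ 2 + k < n) : #F ≤ hammingBallCard k d * n.choose k := by
  set q := 2 * d + 1 with hq
  have hmaps : ∀ v ∈ F \ conflictVecs F q, signSupp v.1 ∈ (univ : Finset (Fin n)).powersetCard k :=
    fun v _ => mem_powersetCard.2 ⟨subset_univ _, card_signSupp v⟩
  have h1 : #(F \ conflictVecs F q) + #(conflictSupps F q) ≤
      hammingBallCard k d * n.choose k := by
    rw [card_eq_sum_card_fiberwise hmaps, conflictSupps, card_filter, ← sum_add_distrib]
    refine (sum_le_card_nsmul _ _ (hammingBallCard k d) fun S hS => ?_).trans_eq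
      (by simp [mul_comm])
    obtain ⟨h2, h3⟩ := card_filter_signSupp_sdiff_conflictVecs_le F hd (mem_powersetCard.1 hS).2
    split_ifs with h
    · exact h3 (mem_filter.2 ⟨hS, h⟩)
    · exact h2
  have h2 := card_conflictVecs_le hd hF hn
  have h3 := card_le_card_sdiff_add_card (s := F) (t := conflictVecs F q)
  omega

end SignVectors

/-! ### The independence number -/

theorem mainTheorem2 (k : ℕ) :
    ∃ n₀ : ℕ, ∀ n : ℕ, n₀ < n → ∀ t : ℤ, Odd t → t < 0 → -(k : ℤ) ≤ t →
      (signedJohnson n k t).indepNum = kleitmanBound k (t.natAbs - 1) * n.choose k := by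
  -- A support carries `2 ^ k` sign patterns and at most `4 ^ k` conflicts. One factor `k` is for the
  -- points of a support outside `T`, the other is the numerator of the ratio `(k - q) / (n - q)`
  -- between the binomial coefficients counting supports through `q + 1` and through `q` points.
  refine ⟨8 ^ k * k ^ 2 + k, fun n hn t ht ht0 htk => ?_⟩
  obtain ⟨d, rfl⟩ : ∃ d : ℕ, t = -((2 * d + 1 : ℕ) : ℤ) := by
    obtain ⟨m, hm⟩ := ht
    exact ⟨(-m - 1).toNat, by omega⟩
  have hbound : kleitmanBound k ((-((2 * d + 1 : ℕ) : ℤ)).natAbs - 1) = hammingBallCard k d := by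
    rw [Int.natAbs_neg, Int.natAbs_natCast, Nat.add_sub_cancel, kleitmanBound,
      if_pos (even_two_mul d), Nat.mul_div_cancel_left d two_pos, hammingBallCard]
  rw [hbound]
  apply le_antisymm
  · obtain ⟨F, hF⟩ := (signedJohnson n k (-((2 * d + 1 : ℕ) : ℤ))).exists_isNIndepSet_indepNum
    rw [← hF.card_eq]
    refine card_le_of_signDot_ne (by omega) (fun v hv w hw hvw => ?_) hn
    have hne : v ≠ w := by
      rintro rfl
      have : 0 ≤ signDot v.1 v.1 := sum_nonneg fun i _ => mul_self_nonneg _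
      omega
    exact hF.isIndepSet hv hw hne ⟨hne, hvw⟩
  -- The vectors with at most `d` negative coordinates are pairwise non-adjacent.
  · rw [← card_filter_card_signNeg_le]
    refine SimpleGraph.IsIndepSet.card_le_indepNum fun v hv w hw _ hadj => ?_
    simp only [coe_filter, Set.mem_ofPred_eq, mem_univ, true_and] at hv hw
    have h1 := neg_le_signDot hv hw
    have h2 := hadj.2
    omega
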